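/- Let $R$ be a commutative ring with $1$, let $N(R)$ be its nilradical, and write $U(\cdot)$ for the group of units of a ring. An element $x$ of a free $R$-module $F$ is called unimodular if there is an $R$-linear map $f:F\to R$ with $f(x)=1$; thus an element of $R^2$ or a matrix in $\mathbb M_2(R)$ is unimodular iff its entries generate the unit ideal. Let $Um(F)$ be the set of unimodular elements of $F$. The ring $R$ is called: - a Hermite ring if each element of $R^2$ is of the form $rw$ with $r\in R$ and $w\in Um(R^2)$; - an elementary divisor ring if for all integers $m,n\ge 1$ and each $m\times n$ matrix $A$ with entries in $R$ there exist $P\in GL_m(R)$ and $Q\in GL_n(R)$ such that the off-diagonal entries of $PAQ$ are $0$ and each diagonal entry of $PAQ$ divides the next one; - a pre-Schreier ring if whenever $x,y,z\in R$ and $x$ divides $yz$, there exist $u,v\in R$ with $x=uv$, $u\mid y$ and $v\mid z$; - a $U_2$ ring if for each $(a,b)\in Um(R^2)$ and each $c\in R$, the product homomorphism $U(R/Rac)\times U(R/Rbc)\to U(R/Rc)$, which sends $(x,y)$ to the product of the reductions of $x$ and $y$ modulo $Rc$, is surjective. A matrix $A\in Um(\mathbb M_2(R))$ is called weakly determinant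 liftable if there exists $B\in\mathbb M_2(R)$ with $\det(B)=0$ such that all entries of $A-B$ belong to $R\det(A)$. **Theorem.** For a Hermite ring $R$ the following statements are equivalent. 1. The ring $R$ is an elementary divisor ring. 2. The ring $R/N(R)$ is a pre-Schreier ring and each matrix in $Um(\mathbb M_2(R))$ is weakly determinant liftable. 3. The ring $R$ is a $U_2$ ring. 4. For all $(a,b)\in Um(R^2)$ and $(c,d)\in Um(R^2)$ there exist $t,d_1,d_2\in R$ such that $d+ct=d_1d_2$, $(a,d_1)\in Um(R^2)$ and $(b,d_2)\in Um(R^2)$. 5. For all $(a,d)\in R^2$ and each $c\in 1+Rd$ there exist $t,d_1,d_2\in R$ such that $d+ct=d_1d_2$, $(a,d_1)\in Um(R^2)$ and $(1-a,d_2)\in Um(R^2)$. -/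

import Mathlib

namespace HermiteRings

universe u v

/-- An element `x` of a (free) `R`-module `F` is unimodular if some linear form on `F` takes the
value `1` at `x`. -/
def IsUnimodular (R : Type u) [CommRing R] {F : Type v} [AddCommGroup F] [Module R F]
    (x : F) : Prop :=
  ∃ f : Module.Dual R F, f x = 1

/-- A pair is unimodular iff its entries are comaximal. -/
theorem isUnimodular_pair_iff {R : Type u} [CommRing R] (a b : R) :
    IsUnimodular R (a, b) ↔ IsCoprime a b := by
  constructor
  · rintro ⟨f, hf⟩
    refine ⟨f (1, 0), f (0, 1), ?_⟩
    have h : (a, b) = a • ((1, 0) : R × R) + b • ((0, 1) : R × R) := by simp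
    rw [h, map_add, map_smul, map_smul, smul_eq_mul, smul_eq_mul] at hf
    linear_combination hf
  · rintro ⟨s, t, h⟩
    exact ⟨s • LinearMap.fst R R R + t • LinearMap.snd R R R, by simpa using h⟩

/-- A matrix is unimodular iff its entries generate the unit ideal. -/
theorem isUnimodular_matrix_iff {R : Type u} [CommRing R] {m n : ℕ}
    (A : Matrix (Fin m) (Fin n) R) :
    IsUnimodular R A ↔ ∃ C : Matrix (Fin m) (Fin n) R, ∑ i, ∑ j, C i j * A i j = 1 := by
  constructor
  · rintro ⟨f, hf⟩
    refine ⟨fun i j => f (Matrix.single i j 1), ?_⟩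
    refine Eq.trans ?_ hf
    conv_rhs => rw [Matrix.matrix_eq_sum_single A]
    simp only [map_sum]
    refine Finset.sum_congr rfl fun i _ => Finset.sum_congr rfl fun j _ => ?_
    have h : Matrix.single i j (A i j) = A i j • Matrix.single i j (1 : R) := by
      rw [Matrix.smul_single, smul_eq_mul, mul_one]
    rw [h, map_smul, smul_eq_mul, mul_comm]
  · rintro ⟨C, hC⟩
    refine ⟨∑ i, ∑ j, C i j • Matrix.entryLinearMap R R i j, ?_⟩
    simpa [LinearMap.sum_apply] using hC

/-- Hermite rings in the sense of Kaplansky: every pair is a multiple of a unimodular pair,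
`R² = R · Um(R²)`. -/
def IsHermiteRing (R : Type u) [CommRing R] : Prop :=
  ∀ v : R × R, ∃ (r : R) (w : R × R), IsUnimodular R w ∧ v = r • w

/-- `A` is equivalent to a matrix whose off-diagonal entries are `0` and each of whose diagonal
entries divides the next one. -/
def AdmitsDiagonalReduction {R : Type u} [CommRing R] {m n : ℕ}
    (A : Matrix (Fin m) (Fin n) R) : Prop :=
  ∃ (P : GL (Fin m) R) (Q : GL (Fin n) R) (D : Matrix (Fin m) (Fin n) R),
    (P : Matrix (Fin m) (Fin m) R) * A * (Q : Matrix (Fin n) (Fin n) R) = D ∧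
    (∀ (i : Fin m) (j : Fin n), (i : ℕ) ≠ (j : ℕ) → D i j = 0) ∧
    ∀ (k : ℕ) (hm : k + 1 < m) (hn : k + 1 < n),
      D ⟨k, Nat.lt_of_succ_lt hm⟩ ⟨k, Nat.lt_of_succ_lt hn⟩ ∣ D ⟨k + 1, hm⟩ ⟨k + 1, hn⟩

/-- Elementary divisor rings. -/
def IsElementaryDivisorRing (R : Type u) [CommRing R] : Prop :=
  ∀ (m n : ℕ), 0 < m → 0 < n → ∀ A : Matrix (Fin m) (Fin n) R, AdmitsDiagonalReduction A

/-- Pre-Schreier rings: every element is primal, i.e. if `x ∣ y * z` then `x = u * v` with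
`u ∣ y` and `v ∣ z`. -/
def IsPreSchreierRing (R : Type u) [CommRing R] : Prop :=
  ∀ x : R, IsPrimal x

/-- `A` is congruent modulo the ideal `R det(A)` to a matrix of determinant `0`. -/
def IsWeaklyDeterminantLiftable {R : Type u} [CommRing R] (A : Matrix (Fin 2) (Fin 2) R) : Prop :=
  ∃ B : Matrix (Fin 2) (Fin 2) R,
    (∀ i j, (A - B) i j ∈ Ideal.span {A.det}) ∧ B.det = 0

/-- The reduction homomorphism `U(R/Rac) → U(R/Rc)`. -/
def unitsReduction {R : Type u} [CommRing R] (a c : R) :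
    (R ⧸ Ideal.span {a * c})ˣ →* (R ⧸ Ideal.span {c})ˣ :=
  Units.map (Ideal.Quotient.factor
    (Ideal.span_singleton_le_span_singleton.mpr (Dvd.intro_left a rfl)) :
      R ⧸ Ideal.span {a * c} →+* R ⧸ Ideal.span {c}).toMonoidHom

/-- The product homomorphism `U(R/Rac) × U(R/Rbc) → U(R/Rc)`. -/
def upsilon {R : Type u} [CommRing R] (a b c : R) :
    (R ⧸ Ideal.span {a * c})ˣ × (R ⧸ Ideal.span {b * c})ˣ →* (R ⧸ Ideal.span {c})ˣ :=
  (unitsReduction a c).coprod (unitsReduction b c)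

/-- `U₂` rings. -/
def IsU2Ring (R : Type u) [CommRing R] : Prop :=
  ∀ a b c : R, IsUnimodular R (a, b) → Function.Surjective (upsilon a b c)

end HermiteRings

/-!
The comaximal factorization condition `HasComaximalFactorizations` mediates between the other
statements. It is a reformulation of the `U₂` property: units modulo `c` are the classes of elements
comaximal with `c` (`hasComaximalFactorizations_iff_isU2Ring`).

Over a Hermite ring it implies Kaplansky's criterion for unimodular triangular `2 × 2` matrices
(`HasComaximalFactorizations.hasKaplanskyProperty`), and this criterion gives diagonal reduction of
all matrices: an induction on the number of columns shows that the bilinear form of every unimodular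
matrix takes the value `1` (`HasKaplanskyProperty.exists_dual_sum_smul_eq_one`), whence the content
of any matrix splits off as a direct summand (`HasKaplanskyProperty.exists_equiv_eq_mulVec`). The
complements are free because unimodular rows over a Hermite ring are completable.

Conversely, reducing `!![c * a, e; 0, c * b]` to diagonal form factors the inverse of `e` modulo `c`
(`IsElementaryDivisorRing.hasComaximalFactorizations`), and replacing the second diagonal entry of
the reduced form by `0` gives weak determinant lifts. The factorization condition and the Hermite
property pass to `R / N(R)`, where they imply the pre-Schreier property
(`HasComaximalFactorizations.isPreSchreierRing`). Finally, a weak determinant lift of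
`!![c * a, d; 0, c * b]` turns the factorization of `d` modulo `c` into the primality of one entry,
which is available modulo nilpotents
(`hasComaximalFactorizations_of_isWeaklyDeterminantLiftable`).
-/

namespace HermiteRings

/-! ### Comaximal factorizations modulo an element -/

section ComaximalFactorizations

variable {R : Type*} [CommRing R]

/-- Every element `d` comaximal with `c` factors modulo `c` into two elements comaximal with the
two members of a given comaximal pair `(a, b)`. This is the condition through which all the others
are compared. -/
def HasComaximalFactorizations (R : Type*) [CommRing R] : Prop :=
  ∀ a b c d : R, IsCoprime a b → IsCoprime c d →
    ∃ t d₁ d₂ : R, d + c * t = d₁ * d₂ ∧ IsCoprime a d₁ ∧ IsCoprime b d₂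

theorem isCoprime_of_forall_isMaximal {a b : R}
    (h : ∀ M : Ideal R, M.IsMaximal → a ∈ M → b ∈ M → False) : IsCoprime a b := by
  rw [← Ideal.isCoprime_span_singleton_iff, Ideal.isCoprime_iff_sup_eq]
  by_contra hne
  obtain ⟨M, hM, hle⟩ := Ideal.exists_le_maximal _ hne
  rw [sup_le_iff, Ideal.span_singleton_le_iff_mem, Ideal.span_singleton_le_iff_mem] at hle
  exact h M hM hle.1 hle.2

theorem IsHermiteRing.exists_isCoprime (hR : IsHermiteRing R) (a b : R) :
    ∃ g a' b' : R, IsCoprime a' b' ∧ a = g * a' ∧ b = g * b' := by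
  obtain ⟨g, ⟨a', b'⟩, hw, h⟩ := hR (a, b)
  simp only [Prod.smul_mk, smul_eq_mul, Prod.mk.injEq] at h
  exact ⟨g, a', b', (isUnimodular_pair_iff _ _).1 hw, h.1, h.2⟩

theorem hasComaximalFactorizations_iff_pairs :
    HasComaximalFactorizations R ↔
      ∀ a b c d : R, IsUnimodular R (a, b) → IsUnimodular R (c, d) →
        ∃ t d₁ d₂ : R, d + c * t = d₁ * d₂ ∧
          IsUnimodular R (a, d₁) ∧ IsUnimodular R (b, d₂) := by
  simp only [HasComaximalFactorizations, isUnimodular_pair_iff]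

theorem hasComaximalFactorizations_iff_one_sub :
    HasComaximalFactorizations R ↔
      ∀ a d c : R, (∃ r : R, c = 1 + r * d) →
        ∃ t d₁ d₂ : R, d + c * t = d₁ * d₂ ∧
          IsUnimodular R (a, d₁) ∧ IsUnimodular R (1 - a, d₂) := by
  simp only [isUnimodular_pair_iff]
  constructor
  · rintro h a d _ ⟨r, rfl⟩
    exact h a (1 - a) _ d ⟨1, 1, by ring⟩ ⟨1, -r, by ring⟩
  · rintro h a b c d ⟨s, t, hst⟩ ⟨p, q, hpq⟩
    obtain ⟨x, d₁, d₂, hx, h₁, h₂⟩ := h (s * a) d (p * c) ⟨-q, by linear_combination hpq⟩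
    refine ⟨p * x, d₁, d₂, by linear_combination hx, h₁.of_mul_left_right, ?_⟩
    rw [show 1 - s * a = t * b by linear_combination -hst] at h₂
    exact h₂.of_mul_left_right

theorem isUnit_quotient_mk_span_singleton_iff (c d : R) :
    IsUnit (Ideal.Quotient.mk (Ideal.span {c}) d) ↔ IsCoprime c d := by
  rw [isUnit_iff_exists_inv]
  constructor
  · rintro ⟨e, he⟩
    obtain ⟨e, rfl⟩ := Ideal.Quotient.mk_surjective e
    rw [← map_mul, ← map_one (Ideal.Quotient.mk _), Ideal.Quotient.mk_eq_mk_iff_sub_mem,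
      Ideal.mem_span_singleton'] at he
    obtain ⟨k, hk⟩ := he
    exact ⟨-k, e, by linear_combination -hk⟩
  · rintro ⟨k, e, h⟩
    refine ⟨Ideal.Quotient.mk _ e, ?_⟩
    rw [← map_mul, ← map_one (Ideal.Quotient.mk _), Ideal.Quotient.mk_eq_mk_iff_sub_mem,
      Ideal.mem_span_singleton']
    exact ⟨-k, by linear_combination -h⟩

/-- Units modulo `c` are classes of elements comaximal with `c`, and a factor modulo `c` of such
an element is itself comaximal with `c`, so being a unit modulo `a * c` is for it the same as being
comaximal with `a`. -/
theorem hasComaximalFactorizations_iff_isU2Ring :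
    HasComaximalFactorizations R ↔ IsU2Ring R := by
  constructor
  · intro h a b c hab x
    obtain ⟨d, hd⟩ := Ideal.Quotient.mk_surjective (x : R ⧸ Ideal.span {c})
    have hcd : IsCoprime c d := by
      rw [← isUnit_quotient_mk_span_singleton_iff, hd]
      exact x.isUnit
    obtain ⟨t, d₁, d₂, ht, h₁, h₂⟩ := h a b c d ((isUnimodular_pair_iff _ _).1 hab) hcd
    have hc : IsCoprime c (d₁ * d₂) := by
      rw [← ht]
      exact IsCoprime.add_mul_left_right hcd t
    have hu₁ := (isUnit_quotient_mk_span_singleton_iff (a * c) d₁).2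
      (h₁.mul_left hc.of_mul_right_left)
    have hu₂ := (isUnit_quotient_mk_span_singleton_iff (b * c) d₂).2
      (h₂.mul_left hc.of_mul_right_right)
    refine ⟨(hu₁.unit, hu₂.unit), Units.ext ?_⟩
    rw [← hd]
    simp only [upsilon, unitsReduction, MonoidHom.coprod_apply, Units.val_mul, Units.coe_map,
      IsUnit.unit_spec, RingHom.toMonoidHom_eq_coe, MonoidHom.coe_coe, Ideal.Quotient.factor_mk]
    rw [← map_mul, Ideal.Quotient.mk_eq_mk_iff_sub_mem, Ideal.mem_span_singleton']
    exact ⟨t, by linear_combination ht⟩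
  · intro h a b c d hab hcd
    have hu := (isUnit_quotient_mk_span_singleton_iff c d).2 hcd
    obtain ⟨⟨y, z⟩, hyz⟩ := h a b c ((isUnimodular_pair_iff _ _).2 hab) hu.unit
    obtain ⟨d₁, h₁⟩ := Ideal.Quotient.mk_surjective (y : R ⧸ Ideal.span {a * c})
    obtain ⟨d₂, h₂⟩ := Ideal.Quotient.mk_surjective (z : R ⧸ Ideal.span {b * c})
    have hc₁ : IsCoprime (a * c) d₁ := by
      rw [← isUnit_quotient_mk_span_singleton_iff, h₁]
      exact y.isUnit
    have hc₂ : IsCoprime (b * c) d₂ := by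
      rw [← isUnit_quotient_mk_span_singleton_iff, h₂]
      exact z.isUnit
    have hval := congrArg Units.val hyz
    simp only [upsilon, unitsReduction, MonoidHom.coprod_apply, Units.val_mul, Units.coe_map,
      IsUnit.unit_spec, RingHom.toMonoidHom_eq_coe, MonoidHom.coe_coe, ← h₁, ← h₂,
      Ideal.Quotient.factor_mk] at hval
    rw [← map_mul, Ideal.Quotient.mk_eq_mk_iff_sub_mem, Ideal.mem_span_singleton'] at hval
    obtain ⟨t, ht⟩ := hval
    exact ⟨t, d₁, d₂, by linear_combination ht, hc₁.of_mul_left_left, hc₂.of_mul_left_left⟩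

theorem HasComaximalFactorizations.of_surjective {S : Type*} [CommRing S]
    (h : HasComaximalFactorizations R) (φ : R →+* S) (hφ : Function.Surjective φ) :
    HasComaximalFactorizations S := by
  rw [hasComaximalFactorizations_iff_one_sub] at h ⊢
  simp only [isUnimodular_pair_iff] at h ⊢
  -- In this form the condition quantifies over arbitrary elements, which lift along `φ`.
  rintro a d _ ⟨r, rfl⟩
  obtain ⟨a, rfl⟩ := hφ a
  obtain ⟨d, rfl⟩ := hφ d
  obtain ⟨r, rfl⟩ := hφ r
  obtain ⟨t, d₁, d₂, ht, h₁, h₂⟩ := h a d _ ⟨r, rfl⟩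
  refine ⟨φ t, φ d₁, φ d₂, ?_, h₁.map φ, ?_⟩
  · simpa using congrArg φ ht
  · simpa using h₂.map φ

theorem IsHermiteRing.of_surjective {S : Type*} [CommRing S]
    (h : IsHermiteRing R) (φ : R →+* S) (hφ : Function.Surjective φ) : IsHermiteRing S := by
  rintro ⟨a, b⟩
  obtain ⟨a, rfl⟩ := hφ a
  obtain ⟨b, rfl⟩ := hφ b
  obtain ⟨g, a', b', hab, rfl, rfl⟩ := h.exists_isCoprime a b
  exact ⟨φ g, (φ a', φ b'), (isUnimodular_pair_iff _ _).2 (hab.map φ), by simp⟩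

end ComaximalFactorizations

/-! ### Pre-Schreier rings and weakly determinant liftable matrices -/

section PreSchreier

variable {R : Type*} [CommRing R]

/-- If `x = g x'` and `y = g y'` with `x'`, `y'` comaximal and `x ∣ y z`, then `z` is a multiple of
`x'` up to an element `f` killed by `g`. Write `x' = k x₂`, `f = k f₂` and `g = l g₁`, `k = l k₁`
with comaximal pairs `(x₂, f₂)` and `(g₁, k₁)`, and factor `x₂` modulo `f₂` as `d₁ d₂`, with `d₁`
comaximal with `k₁` and `d₂` with `g₁`. Then `x = (g d₁) (k d₂)`, where `g d₁ ∣ g ∣ y` and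
`k d₂ ∣ k ∣ z`. Reducedness reduces the relation `g k f₂ = 0` to `l g₁ k₁ f₂ = 0`. -/
theorem HasComaximalFactorizations.isPreSchreierRing [IsReduced R] (hR : IsHermiteRing R)
    (h : HasComaximalFactorizations R) : IsPreSchreierRing R := by
  rintro x y z ⟨w, hw⟩
  obtain ⟨g, x', y', ⟨p, q, hpq⟩, rfl, rfl⟩ := hR.exists_isCoprime x y
  obtain ⟨k, x₂, f₂, hx₂, hx', hf⟩ := hR.exists_isCoprime x' (q * (y' * z - x' * w))
  have hz : z = x' * (p * z + q * w) + q * (y' * z - x' * w) := by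
    linear_combination -z * hpq
  obtain ⟨l, g₁, k₁, hgk, hg, hk⟩ := hR.exists_isCoprime g k
  have hgf : g * (k * f₂) = 0 := by
    rw [← hf]
    linear_combination q * hw
  have hlgk : l * g₁ * k₁ * f₂ = 0 := by
    refine pow_eq_zero_iff (two_ne_zero) |>.1 ?_
    rw [hg, hk] at hgf
    linear_combination g₁ * k₁ * f₂ * hgf
  obtain ⟨t, d₁, d₂, ht, h₁, h₂⟩ := h k₁ g₁ f₂ x₂ hgk.symm hx₂.symm
  have hfd : IsCoprime f₂ (d₁ * d₂) := by
    rw [← ht]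
    exact IsCoprime.add_mul_left_right hx₂.symm t
  obtain ⟨r₁, s₁, e₁⟩ := h₁.mul_left hfd.of_mul_right_left
  obtain ⟨r₂, s₂, e₂⟩ := h₂.mul_left hfd.of_mul_right_right
  have hg₁ : g * d₁ ∣ g := ⟨s₁, by rw [hg]; linear_combination -l * g₁ * e₁ + r₁ * hlgk⟩
  have hk₂ : k * d₂ ∣ k := ⟨s₂, by rw [hk]; linear_combination -l * k₁ * e₂ + r₂ * hlgk⟩
  refine ⟨g * d₁, k * d₂, hg₁.mul_right _, hk₂.trans ?_, ?_⟩
  · rw [hz, hf, hx']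
    exact dvd_add (by rw [mul_assoc]; exact dvd_mul_right _ _) (dvd_mul_right _ _)
  · rw [hx']
    linear_combination g * k * ht - t * hgf

/-- For comaximal pairs `(a, b)` and `(c, d)`, a lift `B` of `!![c * a, d; 0, c * b]` of determinant
zero has an upper right entry that is congruent to `d` modulo `c` and divides the product of the
diagonal entries; primality of this entry splits `d` modulo `c`. -/
theorem hasComaximalFactorizations_of_isWeaklyDeterminantLiftable
    (hS : IsPreSchreierRing (R ⧸ nilradical R))
    (hL : ∀ A : Matrix (Fin 2) (Fin 2) R, IsUnimodular R A → IsWeaklyDeterminantLiftable A) :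
    HasComaximalFactorizations R := by
  rintro a b c d hab hcd
  obtain ⟨B, hB, hdet⟩ := hL !![c * a, d; 0, c * b] (by
    obtain ⟨s, t, hst⟩ := hab
    obtain ⟨u, v, huv⟩ := hcd
    refine (isUnimodular_matrix_iff _).2 ⟨!![u * s, v; 0, u * t], ?_⟩
    simp only [Fin.sum_univ_two, Matrix.of_apply, Matrix.cons_val', Matrix.cons_val_zero,
      Matrix.cons_val_one, Matrix.cons_val_fin_one]
    linear_combination u * c * hst + huv)
  simp only [Matrix.det_fin_two_of, Ideal.mem_span_singleton', Matrix.sub_apply] at hB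
  rw [Matrix.det_fin_two] at hdet
  obtain ⟨k₀₀, h₀₀⟩ := hB 0 0
  obtain ⟨k₀₁, h₀₁⟩ := hB 0 1
  obtain ⟨k₁₁, h₁₁⟩ := hB 1 1
  simp only [Matrix.of_apply, Matrix.cons_val', Matrix.cons_val_zero, Matrix.cons_val_one,
    Matrix.cons_val_fin_one] at h₀₀ h₀₁ h₁₁
  let π := Ideal.Quotient.mk (nilradical R)
  obtain ⟨α, δ, hα, hδ, hαδ⟩ := hS (π (B 0 1)) (b := π (B 0 0)) (c := π (B 1 1))
    ⟨π (B 1 0), by rw [← map_mul, ← map_mul]; exact congrArg π (by linear_combination hdet)⟩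
  obtain ⟨α, rfl⟩ := Ideal.Quotient.mk_surjective α
  obtain ⟨δ, rfl⟩ := Ideal.Quotient.mk_surjective δ
  obtain ⟨r, hr⟩ := hα
  obtain ⟨r, rfl⟩ := Ideal.Quotient.mk_surjective r
  obtain ⟨s, hs⟩ := hδ
  obtain ⟨s, rfl⟩ := Ideal.Quotient.mk_surjective s
  rw [← map_mul, Ideal.Quotient.mk_eq_mk_iff_sub_mem] at hαδ hr hs
  have hnil : ∀ M : Ideal R, M.IsMaximal → nilradical R ≤ M := fun M hM =>
    nilradical_le_prime M (H := hM.isPrime)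
  -- `B 0 1` is `d` modulo `c` and `α * δ` modulo nilpotents, so no maximal ideal contains both `c`
  -- and `α * δ`.
  have hcM : ∀ M : Ideal R, M.IsMaximal → c ∈ M → α * δ ∈ M → False := by
    intro M hM hc hm
    have h1 : B 0 1 ∈ M := by
      simpa using M.add_mem (hnil M hM hαδ) hm
    have h2 : d ∈ M := by
      have := M.add_mem h1 (M.mul_mem_left (k₀₁ * c * a * b) hc)
      convert this using 1
      linear_combination -h₀₁
    obtain ⟨u, v, huv⟩ := hcd
    exact hM.ne_top ((Ideal.eq_top_iff_one M).2
      (huv ▸ M.add_mem (M.mul_mem_left u hc) (M.mul_mem_left v h2)))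
  have habM : ∀ M : Ideal R, M.IsMaximal → a ∈ M → b ∈ M → False := by
    intro M hM ha hb
    obtain ⟨u, v, huv⟩ := hab
    exact hM.ne_top ((Ideal.eq_top_iff_one M).2
      (huv ▸ M.add_mem (M.mul_mem_left u ha) (M.mul_mem_left v hb)))
  have hbα : IsCoprime b α := by
    refine isCoprime_of_forall_isMaximal fun M hM hb hαM => ?_
    have h1 : c * a ∈ M := by
      have := M.add_mem (M.add_mem (hnil M hM hr) (M.mul_mem_right r hαM))
        (M.mul_mem_left (k₀₀ * c * a * c) hb)
      convert this using 1
      linear_combination -h₀₀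
    rcases hM.isPrime.mem_or_mem h1 with hc | ha
    · exact hcM M hM hc (M.mul_mem_right δ hαM)
    · exact habM M hM ha hb
  have haδ : IsCoprime a δ := by
    refine isCoprime_of_forall_isMaximal fun M hM ha hδM => ?_
    have h1 : c * b ∈ M := by
      have := M.add_mem (M.add_mem (hnil M hM hs) (M.mul_mem_right s hδM))
        (M.mul_mem_left (k₁₁ * c * b * c) ha)
      convert this using 1
      linear_combination -h₁₁
    rcases hM.isPrime.mem_or_mem h1 with hc | hb
    · exact hcM M hM hc (M.mul_mem_left α hδM)
    · exact habM M hM ha hb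
  -- The nilpotent error `n` is absorbed into a multiple of `c` and a unit factor.
  obtain ⟨u, v, huv⟩ := hcd
  set n := B 0 1 - α * δ with hn
  have hω : IsUnit (1 - v * n) :=
    (mem_nilradical.1 ((nilradical R).mul_mem_left v hαδ)).isUnit_one_sub
  obtain ⟨ω, hω⟩ := hω.exists_left_inv
  refine ⟨-ω * (k₀₁ * c * a * b + u * n), δ, ω * α, ?_, haδ, ?_⟩
  · linear_combination -d * hω - ω * n * huv - ω * h₀₁ - ω * hn
  · exact IsCoprime.mul_right ⟨0, 1 - v * n, by linear_combination hω⟩ hbα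

end PreSchreier

/-! ### Unimodular bilinear values over Hermite rings -/

section BilinearValues

variable {R : Type*} [CommRing R]

/-- For a unimodular triangular matrix `!![a, b; 0, c]` there are a row `(p, q)` and a column
`(x, y)` with `(p, q) * !![a, b; 0, c] * (x, y) = 1`. This is Kaplansky's criterion for a Hermite
ring to be an elementary divisor ring. -/
def HasKaplanskyProperty (R : Type*) [CommRing R] : Prop :=
  ∀ a b c : R, (∃ α β γ : R, α * a + β * b + γ * c = 1) →
    ∃ p q x y : R, p * a * x + p * b * y + q * c * y = 1

/-- Write `(a, c) = g (a', c')` with `(a', c')` unimodular. It suffices to find comaximal `p`, `y`,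
with `y` comaximal with `a'`, `p` with `c'`, and `p b y ≡ 1` modulo `g`, since then
`(a' p, c' y)` is unimodular and `1 - p b y` can be written as `g (a' p x + c' y q)`. Apart from the
comaximality of `p` and `y`, such elements come from a factorization of an inverse of `b` modulo
`g`. -/
theorem HasComaximalFactorizations.hasKaplanskyProperty (hR : IsHermiteRing R)
    (h : HasComaximalFactorizations R) : HasKaplanskyProperty R := by
  rintro a b c ⟨α, β, γ, habc⟩
  obtain ⟨g, a', c', hac, rfl, rfl⟩ := hR.exists_isCoprime a c
  obtain ⟨t, y₀, p₀, ht, hy₀, hp₀⟩ := h a' c' g β hac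
    ⟨α * a' + γ * c', b, by linear_combination habc⟩
  have hg : IsCoprime g (y₀ * p₀) := by
    rw [← ht]
    exact IsCoprime.add_mul_left_right ⟨α * a' + γ * c', b, by linear_combination habc⟩ t
  obtain ⟨k, p', y', ⟨v, u, huv⟩, rfl, rfl⟩ := hR.exists_isCoprime p₀ y₀
  have hk : IsCoprime k (g * a' * c') :=
    IsCoprime.mul_right (IsCoprime.mul_right hg.of_mul_right_right.of_mul_right_left.symm
      hy₀.of_mul_right_left.symm) hp₀.of_mul_right_left.symm
  -- `(p', y')` completes to a basis with `(-u, v)`; adding a multiple of the latter by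
  -- `g * a' * c'`, which is comaximal with `k`, makes `k • (p', y')` unimodular.
  obtain ⟨p, hp⟩ : ∃ p, p = k * p' - g * a' * c' * u := ⟨_, rfl⟩
  obtain ⟨y, hy⟩ : ∃ y, y = k * y' + g * a' * c' * v := ⟨_, rfl⟩
  have hpy : IsCoprime p y := by
    obtain ⟨r, s, hrs⟩ := hk
    refine ⟨r * v - s * y', r * u + s * p', ?_⟩
    rw [hp, hy]
    linear_combination (r * k + s * g * a' * c') * huv + hrs
  have hcp : IsCoprime c' p := by
    rw [hp, show k * p' - g * a' * c' * u = k * p' + c' * (-(g * a' * u)) by ring]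
    exact IsCoprime.add_mul_left_right hp₀ _
  have hay : IsCoprime a' y := by
    rw [hy, show k * y' + g * a' * c' * v = k * y' + a' * (g * c' * v) by ring]
    exact IsCoprime.add_mul_left_right hy₀ _
  obtain ⟨x, q, hxq⟩ : IsCoprime (a' * p) (c' * y) :=
    IsCoprime.mul_right (IsCoprime.mul_left hac hcp.symm) (IsCoprime.mul_left hay hpy)
  obtain ⟨e, he⟩ : ∃ e, 1 - p * b * y = g * e := by
    refine ⟨α * a' + γ * c' - b * (t + a' * c' * (k * p' * v - k * y' * u
      - g * a' * c' * u * v)), ?_⟩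
    rw [hp, hy]
    linear_combination -habc + b * ht
  exact ⟨p, e * q, e * x, y, by linear_combination g * e * hxq - he⟩

/-- Modules in which every element is a multiple of a unimodular one; `R` is a Hermite ring when
`R × R` is such a module. -/
def IsHermiteModule (R : Type*) [CommRing R] (F : Type*) [AddCommGroup F] [Module R F] : Prop :=
  ∀ v : F, ∃ (r : R) (w : F), IsUnimodular R w ∧ v = r • w

variable {V W : Type*} [AddCommGroup V] [Module R V] [AddCommGroup W] [Module R W]

theorem IsHermiteModule.of_equiv (hV : IsHermiteModule R V) (e : V ≃ₗ[R] W) :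
    IsHermiteModule R W := by
  intro v
  obtain ⟨r, w, ⟨φ, hφ⟩, h⟩ := hV (e.symm v)
  exact ⟨r, e w, ⟨φ ∘ₗ e.symm.toLinearMap, by simpa using hφ⟩,
    by rw [← map_smul, ← h, e.apply_symm_apply]⟩

theorem isHermiteModule_self : IsHermiteModule R R :=
  fun v => ⟨v, 1, ⟨LinearMap.id, rfl⟩, by simp⟩

theorem IsHermiteModule.prod (hR : IsHermiteRing R) (hV : IsHermiteModule R V)
    (hW : IsHermiteModule R W) : IsHermiteModule R (V × W) := by
  rintro ⟨v, w⟩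
  obtain ⟨r, v', ⟨φ, hφ⟩, rfl⟩ := hV v
  obtain ⟨s, w', ⟨ψ, hψ⟩, rfl⟩ := hW w
  obtain ⟨g, r', s', ⟨α, β, h⟩, rfl, rfl⟩ := hR.exists_isCoprime r s
  refine ⟨g, (r' • v', s' • w'), ⟨α • φ ∘ₗ LinearMap.fst R V W + β • ψ ∘ₗ LinearMap.snd R V W, ?_⟩,
    by simp [mul_smul]⟩
  simpa [hφ, hψ] using h

theorem IsHermiteModule.pi (hR : IsHermiteRing R) (hV : IsHermiteModule R V) (n : ℕ) :
    IsHermiteModule R (Fin (n + 1) → V) := by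
  induction n with
  | zero => exact hV.of_equiv (LinearEquiv.funUnique (Fin 1) R V).symm
  | succ n ih => exact (hV.prod hR ih).of_equiv (Fin.consLinearEquiv R fun _ => V)

/-- The bilinear form of a unimodular matrix with columns `b` takes the value `1`. In the induction
on the number of columns, those after the first are `h • b'` with `b'` unimodular, so that
`p' u = 1` for some functional `p'` and some combination `u` of `b'`. Splitting the first column
along `u` and `ker p'`, and taking a functional that vanishes at `u` and takes the content of the
second component as its value there, leads to a unimodular triangular `2 × 2` matrix. -/
theorem HasKaplanskyProperty.exists_dual_sum_smul_eq_one (hK : HasKaplanskyProperty R)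
    (hR : IsHermiteRing R) (hV : IsHermiteModule R V) (n : ℕ) (b : Fin (n + 1) → V)
    (hb : IsUnimodular R b) :
    ∃ (p : Module.Dual R V) (x : Fin (n + 1) → R), p (∑ j, x j • b j) = 1 := by
  induction n with
  | zero =>
    obtain ⟨F, hF⟩ := hb
    refine ⟨F ∘ₗ (LinearEquiv.funUnique (Fin 1) R V).symm.toLinearMap, fun _ => 1, ?_⟩
    rw [Fin.sum_univ_one, one_smul, LinearMap.comp_apply]
    refine Eq.trans (congrArg F ?_) hF
    funext i
    rw [Fin.fin_one_eq_zero i]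
    rfl
  | succ n ih =>
    obtain ⟨h, b', hb', hbb⟩ := hV.pi hR n (Fin.tail b)
    obtain ⟨p', x', hpx⟩ := ih b' hb'
    set u := ∑ j, x' j • b' j with hu
    obtain ⟨r, w, ⟨φ, hφ⟩, hrw⟩ := hV (b 0 - p' (b 0) • u)
    have hb0 : b 0 = p' (b 0) • u + r • w := by rw [← hrw]; abel
    have hφr : φ (b 0) - φ u * p' (b 0) = r := by
      have := congrArg φ hrw
      simp only [map_sub, map_smul, smul_eq_mul, hφ] at this
      linear_combination this
    obtain ⟨F, hF⟩ := hb
    let e : (V × (Fin (n + 1) → V)) ≃ₗ[R] (Fin (n + 2) → V) := Fin.consLinearEquiv R fun _ => V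
    let G : V × (Fin (n + 1) → V) →ₗ[R] R := F ∘ₗ e.toLinearMap
    have hG : G (b 0, h • b') = 1 := by
      rw [← hF, ← hbb]
      exact congrArg F (Fin.cons_self_tail b)
    have hsplit : (b 0, h • b') = h • ((0 : V), b') + p' (b 0) • (u, (0 : Fin (n + 1) → V))
        + r • (w, (0 : Fin (n + 1) → V)) := by
      simp only [Prod.smul_mk, Prod.mk_add_mk, smul_zero, add_zero, zero_add]
      rw [← hb0]
    rw [hsplit, map_add, map_add, map_smul, map_smul, map_smul, smul_eq_mul, smul_eq_mul,
      smul_eq_mul] at hG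
    obtain ⟨s, t, x, y, hst⟩ := hK h (p' (b 0)) r
      ⟨G (0, b'), G (u, 0), G (w, 0), by linear_combination hG⟩
    refine ⟨s • p' + t • (φ - φ u • p'), Fin.cons y (x • x'), ?_⟩
    have hsum : ∑ j, (Fin.cons y (x • x') : Fin (n + 2) → R) j • b j = y • b 0 + (x * h) • u := by
      rw [Fin.sum_univ_succ, hu, Finset.smul_sum]
      simp only [Fin.cons_zero, Fin.cons_succ]
      congr 1
      refine Finset.sum_congr rfl fun j _ => ?_
      rw [show b j.succ = h • b' j from congrFun hbb j]
      simp only [Pi.smul_apply, smul_smul, smul_eq_mul]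
      congr 1
      ring
    rw [hsum]
    simp only [LinearMap.add_apply, LinearMap.smul_apply, LinearMap.sub_apply, map_add, map_smul,
      smul_eq_mul, hpx]
    linear_combination hst + t * y * hφr

end BilinearValues

/-! ### Diagonal reduction of matrices -/

section DiagonalReduction

variable {R : Type*} [CommRing R]

/-- A unimodular pair `(a, b)` is the first row of a matrix of determinant `1`; this is the
automorphism of `R × R` given by that matrix. -/
def prodEquivOfBezout (a b s t : R) (h : a * s + b * t = 1) : (R × R) ≃ₗ[R] (R × R) where
  toFun v := (a * v.1 + b * v.2, -t * v.1 + s * v.2)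
  invFun v := (s * v.1 - b * v.2, t * v.1 + a * v.2)
  map_add' v w := by ext <;> simp <;> ring
  map_smul' c v := by ext <;> simp <;> ring
  left_inv v := by
    ext
    · simp only
      linear_combination v.1 * h
    · simp only
      linear_combination v.2 * h
  right_inv v := by
    ext
    · simp only
      linear_combination v.1 * h
    · simp only
      linear_combination v.2 * h

/-- Over a Hermite ring unimodular rows are completable to invertible matrices: the form
`v ↦ a ⬝ᵥ v` is the first component of an isomorphism onto `R × (Fin n → R)`. -/
theorem IsHermiteRing.exists_equiv_dotProduct (hR : IsHermiteRing R) (n : ℕ) (a : Fin (n + 1) → R)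
    (ha : IsUnimodular R a) :
    ∃ e : (Fin (n + 1) → R) ≃ₗ[R] R × (Fin n → R), ∀ v, (e v).1 = a ⬝ᵥ v := by
  induction n with
  | zero =>
    obtain ⟨F, hF⟩ := ha
    have hu : a 0 * F 1 = 1 := by
      rw [← smul_eq_mul, ← map_smul, ← hF]
      congr 1
      funext i
      rw [Fin.fin_one_eq_zero i]
      simp
    refine ⟨LinearEquiv.smulOfUnit (Units.mkOfMulEqOne _ _ hu) ≪≫ₗ
      (Fin.consLinearEquiv R fun _ => R).symm, fun v => ?_⟩
    rw [dotProduct, Fin.sum_univ_one]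
    rfl
  | succ n ih =>
    obtain ⟨r, w, hw, haw⟩ := isHermiteModule_self.pi hR n (Fin.tail a)
    obtain ⟨e, he⟩ := ih w hw
    obtain ⟨F, hF⟩ := ha
    have hsplit : a = a 0 • Pi.single 0 1 + r • Fin.cons 0 w := by
      funext i
      refine Fin.cases ?_ (fun i => ?_) i
      · simp
      · simpa [Fin.tail] using congrFun haw i
    rw [hsplit, map_add, map_smul, map_smul, smul_eq_mul, smul_eq_mul] at hF
    refine ⟨(Fin.consLinearEquiv R fun _ => R).symm ≪≫ₗ (LinearEquiv.refl R R).prodCongr e ≪≫ₗ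
      (LinearEquiv.prodAssoc R R R (Fin n → R)).symm ≪≫ₗ
      (prodEquivOfBezout _ _ _ _ hF).prodCongr (LinearEquiv.refl R _) ≪≫ₗ
      LinearEquiv.prodAssoc R R R (Fin n → R) ≪≫ₗ
      (LinearEquiv.refl R R).prodCongr (Fin.consLinearEquiv R fun _ => R), fun v => ?_⟩
    have hdot : a ⬝ᵥ v = a 0 * v 0 + r * (w ⬝ᵥ Fin.tail v) := by
      rw [dotProduct, Fin.sum_univ_succ, dotProduct, Finset.mul_sum]
      congr 1
      refine Finset.sum_congr rfl fun i _ => ?_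
      rw [show a i.succ = r * w i from congrFun haw i, mul_assoc]
      rfl
    rw [hdot, ← he]
    rfl

/-- A functional `p` on `R ^ (n + 1)` and a vector `x` with `p x = 1` become the first projection
and the vector `(1, 0)` in suitable coordinates. -/
theorem IsHermiteRing.exists_equiv_dual (hR : IsHermiteRing R) (n : ℕ)
    (p : Module.Dual R (Fin (n + 1) → R)) (x : Fin (n + 1) → R) (hpx : p x = 1) :
    ∃ e : (Fin (n + 1) → R) ≃ₗ[R] R × (Fin n → R), (∀ v, (e v).1 = p v) ∧ e x = (1, 0) := by
  have hp : ∀ v, (fun i => p (Pi.single i 1)) ⬝ᵥ v = p v := by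
    intro v
    conv_rhs => rw [pi_eq_sum_univ' v]
    simp [dotProduct, mul_comm]
  obtain ⟨e, he⟩ := hR.exists_equiv_dotProduct n (fun i => p (Pi.single i 1))
    ⟨dotProductBilin R R |>.flip x, by simpa using (hp x).trans hpx⟩
  refine ⟨e ≪≫ₗ (LinearEquiv.refl R R).skewProd (LinearEquiv.refl R _)
    (-(LinearMap.toSpanSingleton R _ (e x).2)), fun v => ?_, ?_⟩
  · rw [← hp, ← he]
    rfl
  · have h1 : (e x).1 = 1 := by rw [he, hp, hpx]
    ext <;> simp [h1]

/-- The off-diagonal entries vanish and each diagonal entry divides the next one. -/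
def IsSmithDiagonal {m n : ℕ} (D : Matrix (Fin m) (Fin n) R) : Prop :=
  (∀ (i : Fin m) (j : Fin n), (i : ℕ) ≠ (j : ℕ) → D i j = 0) ∧
    ∀ (k : ℕ) (hm : k + 1 < m) (hn : k + 1 < n),
      D ⟨k, Nat.lt_of_succ_lt hm⟩ ⟨k, Nat.lt_of_succ_lt hn⟩ ∣ D ⟨k + 1, hm⟩ ⟨k + 1, hn⟩

/-- The matrix `h • (1 ⊕ D)`. -/
def smulOneSum {m n : ℕ} (h : R) (D : Matrix (Fin m) (Fin n) R) :
    Matrix (Fin (m + 1)) (Fin (n + 1)) R :=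
  Matrix.of (Fin.cons (Fin.cons h 0) fun i => Fin.cons 0 (h • D i))

theorem IsSmithDiagonal.smulOneSum {m n : ℕ} (h : R) {D : Matrix (Fin m) (Fin n) R}
    (hD : IsSmithDiagonal D) : IsSmithDiagonal (smulOneSum h D) := by
  refine ⟨fun i j => ?_, fun k => ?_⟩
  · refine Fin.cases ?_ (fun i => ?_) i <;> refine Fin.cases ?_ (fun j => ?_) j
    · simp
    · simp [HermiteRings.smulOneSum]
    · simp [HermiteRings.smulOneSum]
    · intro hij
      simp [HermiteRings.smulOneSum, hD.1 i j (by simpa using hij)]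
  · cases k with
    | zero => exact fun hm hn => ⟨D ⟨0, by omega⟩ ⟨0, by omega⟩, rfl⟩
    | succ k =>
      exact fun hm hn => mul_dvd_mul_left h (hD.2 k (by omega) (by omega))

theorem smulOneSum_mulVec {m n : ℕ} (h : R) (D : Matrix (Fin m) (Fin n) R)
    (v : Fin (n + 1) → R) :
    (smulOneSum h D).mulVec v = h • (Fin.cons (v 0) (D.mulVec (Fin.tail v)) : Fin (m + 1) → R) := by
  funext i
  refine Fin.cases ?_ (fun i => ?_) i
  · simp [Matrix.mulVec, dotProduct, Fin.sum_univ_succ, smulOneSum]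
  · simp [Matrix.mulVec, dotProduct, Fin.sum_univ_succ, smulOneSum, Finset.mul_sum, mul_assoc,
      Fin.tail]

/-- Writing a linear map as `h • T'` with `T'` unimodular and choosing `p`, `x` with
`p (T' x) = 1`, the map `T'` splits as `1 ⊕ C` along `x`, `ker (p ∘ T')` and `T' x`, `ker p`;
the reduction then proceeds with `C`. -/
theorem HasKaplanskyProperty.exists_equiv_eq_mulVec (hK : HasKaplanskyProperty R)
    (hR : IsHermiteRing R) (m n : ℕ) (T : (Fin n → R) →ₗ[R] (Fin m → R)) :
    ∃ (f : (Fin m → R) ≃ₗ[R] (Fin m → R)) (e : (Fin n → R) ≃ₗ[R] (Fin n → R))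
      (D : Matrix (Fin m) (Fin n) R), (∀ v, f (T (e v)) = D.mulVec v) ∧ IsSmithDiagonal D := by
  induction m generalizing n with
  | zero =>
    exact ⟨.refl R _, .refl R _, 0, fun v => Subsingleton.elim _ _, fun i => i.elim0,
      fun k hm => by omega⟩
  | succ m ih =>
    cases n with
    | zero =>
      exact ⟨.refl R _, .refl R _, 0, fun v => by
        rw [Subsingleton.elim v 0, map_zero, map_zero, map_zero, Matrix.mulVec_zero],
        fun _ j => j.elim0,
        fun k _ hn => by omega⟩
    | succ n =>
      obtain ⟨h, b, hb, hT⟩ := (isHermiteModule_self.pi hR m).pi hR n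
        fun j => T (Pi.single j 1)
      obtain ⟨p, x, hpx⟩ := hK.exists_dual_sum_smul_eq_one hR (isHermiteModule_self.pi hR m) n b hb
      let T' : (Fin (n + 1) → R) →ₗ[R] (Fin (m + 1) → R) := Fintype.linearCombination R b
      have hTT' : T = h • T' := by
        refine LinearMap.pi_ext' fun j => LinearMap.ext_ring ?_
        simpa [T', Fintype.linearCombination_apply_single] using congrFun hT j
      have hpTx : p (T' x) = 1 := by rw [Fintype.linearCombination_apply, hpx]
      obtain ⟨f₀, hf₀, hf₀x⟩ := hR.exists_equiv_dual m p (T' x) hpTx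
      obtain ⟨e₀, he₀, he₀x⟩ := hR.exists_equiv_dual n (p ∘ₗ T') x hpTx
      have he₀x' : e₀.symm (1, 0) = x := by rw [← he₀x, e₀.symm_apply_apply]
      let C : (Fin n → R) →ₗ[R] (Fin m → R) :=
        LinearMap.snd R R _ ∘ₗ f₀.toLinearMap ∘ₗ T' ∘ₗ e₀.symm.toLinearMap ∘ₗ LinearMap.inr R R _
      have hC : ∀ a w, f₀ (T' (e₀.symm (a, w))) = (a, C w) := by
        intro a w
        have hsplit : ((a, w) : R × (Fin n → R)) = a • (1, 0) + (0, w) := by simp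
        ext1
        · rw [hf₀]
          change (p ∘ₗ T') _ = _
          rw [← he₀, e₀.apply_symm_apply]
        · rw [hsplit, map_add, map_smul, he₀x', map_add, map_smul, map_add, map_smul, hf₀x]
          simp [C]
      obtain ⟨f₁, e₁, D, hD, hDs⟩ := ih n C
      refine ⟨f₀ ≪≫ₗ (LinearEquiv.refl R R).prodCongr f₁ ≪≫ₗ Fin.consLinearEquiv R fun _ => R,
        (Fin.consLinearEquiv R fun _ => R).symm ≪≫ₗ (LinearEquiv.refl R R).prodCongr e₁ ≪≫ₗ
          e₀.symm, smulOneSum h D, fun v => ?_, hDs.smulOneSum h⟩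
      have hv : ((Fin.consLinearEquiv R fun _ => R).symm ≪≫ₗ
          (LinearEquiv.refl R R).prodCongr e₁ ≪≫ₗ e₀.symm) v
          = e₀.symm (v 0, e₁ (Fin.tail v)) := rfl
      rw [smulOneSum_mulVec, ← hD, hv, hTT', LinearMap.smul_apply, map_smul]
      congr 1
      simp only [LinearEquiv.trans_apply, hC]
      rfl

theorem HasKaplanskyProperty.isElementaryDivisorRing (hK : HasKaplanskyProperty R)
    (hR : IsHermiteRing R) : IsElementaryDivisorRing R := by
  intro m n _ _ A
  obtain ⟨f, e, D, h, hD⟩ := hK.exists_equiv_eq_mulVec hR m n (Matrix.toLin' A)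
  refine ⟨Units.map LinearMap.toMatrixAlgEquiv'.toMonoidHom
      (LinearMap.GeneralLinearGroup.ofLinearEquiv f),
    Units.map LinearMap.toMatrixAlgEquiv'.toMonoidHom
      (LinearMap.GeneralLinearGroup.ofLinearEquiv e), D, ?_, hD⟩
  change LinearMap.toMatrix' f.toLinearMap * A * LinearMap.toMatrix' e.toLinearMap = D
  refine Matrix.toLin'.injective (LinearMap.ext fun v => ?_)
  simp only [Matrix.toLin'_mul, Matrix.toLin'_toMatrix', LinearMap.comp_apply]
  simpa using h v

/-! ### Consequences of diagonal reduction -/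

theorem AdmitsDiagonalReduction.exists_isUnit {A : Matrix (Fin 2) (Fin 2) R}
    (h : AdmitsDiagonalReduction A) (hA : IsUnimodular R A) :
    ∃ (P Q : GL (Fin 2) R) (ε δ : R), IsUnit ε ∧
      (P : Matrix (Fin 2) (Fin 2) R) * A * (Q : Matrix (Fin 2) (Fin 2) R) = !![ε, 0; 0, δ] := by
  obtain ⟨P, Q, D, hD, hoff, hdvd⟩ := h
  obtain ⟨δ, hδ⟩ := hdvd 0 (by norm_num) (by norm_num)
  change D 1 1 = D 0 0 * δ at hδ
  have hD' : D = D 0 0 • !![1, 0; 0, δ] := by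
    ext i j
    fin_cases i <;> fin_cases j <;> simp [hδ, hoff 0 1, hoff 1 0]
  have hAD : A = D 0 0 • ((P⁻¹ : GL (Fin 2) R).1 * !![1, 0; 0, δ] * (Q⁻¹ : GL (Fin 2) R).1) := by
    rw [← Matrix.smul_mul, ← Matrix.mul_smul, ← hD', ← hD]
    simp only [mul_assoc, Units.mul_inv, mul_one]
    simp only [← mul_assoc, Units.inv_mul, one_mul]
  obtain ⟨F, hF⟩ := hA
  refine ⟨P, Q, D 0 0, D 1 1, ?_, ?_⟩
  · rw [hAD, map_smul, smul_eq_mul] at hF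
    exact IsUnit.of_mul_eq_one _ hF
  · rw [hD]
    ext i j
    fin_cases i <;> fin_cases j <;> simp [hoff 0 1, hoff 1 0]

/-- Diagonal reduction of `!![c * a, e; 0, c * b]`, with `e` inverse to `d` modulo `c`, yields
`(p, q)` and `(x, y)` with `c * (a * p * x + b * q * y) + e * p * y = 1`; then `d ≡ y * p`
modulo `c`. -/
theorem IsElementaryDivisorRing.hasComaximalFactorizations (h : IsElementaryDivisorRing R) :
    HasComaximalFactorizations R := by
  rintro a b c d ⟨s, t, hst⟩ ⟨k, e, hke⟩
  have hA : IsUnimodular R !![c * a, e; 0, c * b] := by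
    refine (isUnimodular_matrix_iff _).2 ⟨!![k * s, d; 0, k * t], ?_⟩
    simp only [Fin.sum_univ_two, Matrix.of_apply, Matrix.cons_val', Matrix.cons_val_zero,
      Matrix.cons_val_one, Matrix.cons_val_fin_one]
    linear_combination k * c * hst + hke
  obtain ⟨P, Q, ε, δ, hε, hPQ⟩ :=
    (h 2 2 two_pos two_pos !![c * a, e; 0, c * b]).exists_isUnit hA
  obtain ⟨η, hη⟩ := hε.exists_right_inv
  have h00 := congrFun (congrFun hPQ 0) 0
  simp only [Matrix.mul_apply, Fin.sum_univ_two, Matrix.of_apply, Matrix.cons_val',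
    Matrix.cons_val_zero, Matrix.cons_val_one, Matrix.cons_val_fin_one] at h00
  generalize P.1 0 0 = p, P.1 0 1 = q, Q.1 0 0 = x, Q.1 1 0 = y at h00
  refine ⟨η * (k * p * y - d * (a * p * x + b * q * y)), y, p * η, ?_,
    ⟨c * p * x * η, η * (c * b * q + e * p), ?_⟩, ⟨c * q * y * η, c * a * x + e * y, ?_⟩⟩
  · linear_combination -d * hη - d * η * h00 + η * p * y * hke
  · linear_combination η * h00 + hη
  · linear_combination η * h00 + hη

theorem AdmitsDiagonalReduction.isWeaklyDeterminantLiftable {A : Matrix (Fin 2) (Fin 2) R}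
    (h : AdmitsDiagonalReduction A) (hA : IsUnimodular R A) : IsWeaklyDeterminantLiftable A := by
  obtain ⟨P, Q, ε, δ, hε, hPQ⟩ := h.exists_isUnit hA
  obtain ⟨η, hη⟩ := hε.exists_right_inv
  have hδ : δ = A.det * (η * P.1.det * Q.1.det) := by
    have := congrArg Matrix.det hPQ
    rw [Matrix.det_mul, Matrix.det_mul, Matrix.det_fin_two_of] at this
    linear_combination -η * this - δ * hη
  have hA' : A = (P⁻¹ : GL (Fin 2) R).1 * !![ε, 0; 0, δ] * (Q⁻¹ : GL (Fin 2) R).1 := by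
    rw [← hPQ]
    simp only [mul_assoc, Units.mul_inv, mul_one]
    simp only [← mul_assoc, Units.inv_mul, one_mul]
  refine ⟨(P⁻¹ : GL (Fin 2) R).1 * !![ε, 0; 0, 0] * (Q⁻¹ : GL (Fin 2) R).1, fun i j => ?_, ?_⟩
  · have hsub : A - (P⁻¹ : GL (Fin 2) R).1 * !![ε, 0; 0, 0] * (Q⁻¹ : GL (Fin 2) R).1
        = δ • ((P⁻¹ : GL (Fin 2) R).1 * !![0, 0; 0, 1] * (Q⁻¹ : GL (Fin 2) R).1) := by
      rw [← Matrix.smul_mul, ← Matrix.mul_smul]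
      conv_lhs => rw [hA']
      rw [← sub_mul, ← mul_sub]
      congr 2
      ext i j
      fin_cases i <;> fin_cases j <;> simp
    rw [hsub, Ideal.mem_span_singleton, Matrix.smul_apply, smul_eq_mul]
    exact Dvd.dvd.mul_right ⟨_, hδ⟩ _
  · simp [Matrix.det_mul, Matrix.det_fin_two_of]

end DiagonalReduction

end HermiteRings

theorem mainTheorem1 {R : Type*} [CommRing R] (hR : HermiteRings.IsHermiteRing R) :
    List.TFAE [
      HermiteRings.IsElementaryDivisorRing R,
      HermiteRings.IsPreSchreierRing (R ⧸ nilradical R) ∧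
        ∀ A : Matrix (Fin 2) (Fin 2) R, HermiteRings.IsUnimodular R A →
          HermiteRings.IsWeaklyDeterminantLiftable A,
      HermiteRings.IsU2Ring R,
      ∀ a b c d : R, HermiteRings.IsUnimodular R (a, b) → HermiteRings.IsUnimodular R (c, d) →
        ∃ t d₁ d₂ : R, d + c * t = d₁ * d₂ ∧
          HermiteRings.IsUnimodular R (a, d₁) ∧ HermiteRings.IsUnimodular R (b, d₂),
      ∀ a d c : R, (∃ r : R, c = 1 + r * d) →
        ∃ t d₁ d₂ : R, d + c * t = d₁ * d₂ ∧
          HermiteRings.IsUnimodular R (a, d₁) ∧ HermiteRings.IsUnimodular R (1 - a, d₂)] := by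
  rw [← HermiteRings.hasComaximalFactorizations_iff_isU2Ring,
    ← HermiteRings.hasComaximalFactorizations_iff_pairs,
    ← HermiteRings.hasComaximalFactorizations_iff_one_sub]
  tfae_have 1 → 2 := by
    intro h
    have hπ := Ideal.Quotient.mk_surjective (I := nilradical R)
    have : IsReduced (R ⧸ nilradical R) :=
      (Ideal.isRadical_iff_quotient_reduced _).1 (Ideal.radical_isRadical _)
    exact ⟨(h.hasComaximalFactorizations.of_surjective _ hπ).isPreSchreierRing
      (hR.of_surjective _ hπ), fun A hA => (h 2 2 two_pos two_pos A).isWeaklyDeterminantLiftable hA⟩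
  tfae_have 2 → 3 := fun h =>
    HermiteRings.hasComaximalFactorizations_of_isWeaklyDeterminantLiftable h.1 h.2
  tfae_have 3 → 4 := id
  tfae_have 4 → 5 := id
  tfae_have 5 → 1 := fun h => (h.hasKaplanskyProperty hR).isElementaryDivisorRing hR
  tfae_finish
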